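/- Let $R$ be a commutative ring with identity and let $C$ be a semidualizing $R$-module: $C$ has a projective resolution by finitely generated projective modules, the homothety map $R\to \mathrm{Hom}_R(C,C)$ is an isomorphism, and $\mathrm{Ext}_R^i(C,C)=0$ for all $i\ge 1$. Let $\mathrm{Ch}(R)$ be the category of (unbounded) complexes of $R$-modules. Let $\mathcal P$ be the class of projective $R$-modules, $\mathcal P_C$ the class of modules isomorphic to $C\otimes_R P$ with $P$ projective, and $\mathcal F_C$ the class of modules isomorphic to $C\otimes_R F$ with $F$ flat. For a class $\mathcal X$ of modules, let $\widetilde{\mathcal X}$ be the class of exact complexes all of whose cycle modules lie in $\mathcal X$. A complex $G$ is called $D_C$-projective if there is an exact sequence in $\mathrm{Ch}(R)$ $$\cdots\to P_1\to P_0\xrightarrow{f_0} Q_{-1}\to Q_{-2}\to\cdots$$ with all $P_i\in\widetilde{\mathcal P}$ and all $Q_i\in\widetilde{\mathcal P_C}$ that stays exact under $\mathrm{Hom}(-,H)$ for every $H\in\widetilde{\mathcal F_C}$, and such that $G\cong \mathrm{Im} f_0$. For a complex $X$, let $D_C\text{-pd}(X)$ (resp. $\mathcal P_C\text{-pd}(X)$)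 be the least integer $n\ge 0$ for which there is an exact sequence $0\to G_n\to\cdots\to G_0\to X\to 0$ in $\mathrm{Ch}(R)$ with all $G_i$ $D_C$-projective (resp. in $\widetilde{\mathcal P_C}$), and $\infty$ if there is none. Let $X\in \mathrm{Ch}(R)$ with $D_C\text{-pd}(X)=n<\infty$. Then: (1) There is an exact sequence $0\to X\to Y\to G\to 0$ in $\mathrm{Ch}(R)$ with $G$ $D_C$-projective and $\mathcal P_C\text{-pd}(Y)=n$. (2) $X$ has a special $D_C$-projective precover, i.e. there is an exact sequence $0\to K\to G\to X\to 0$ in $\mathrm{Ch}(R)$ with $G$ $D_C$-projective and $\mathrm{Ext}^1(G',K)=0$ for every $D_C$-projective complex $G'$, such that moreover $\mathcal P_C\text{-pd}(K)=n-1$ if $n>0$, and $K=0$ if $n=0$. -/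

import Mathlib

open CategoryTheory CategoryTheory.Limits
open scoped TensorProduct

universe u v

namespace RelDing

noncomputable section

section Abelian

variable {A : Type u} [Category.{v} A] [Abelian A]

/-- A (cohomologically indexed, unbounded) sequence `E` in `A` is `Hom(-, 𝓑)`-exact: for every `B`
in `𝓑` and every `i`, the sequence of abelian groups
`Hom(E (i+1), B) ⟶ Hom(E i, B) ⟶ Hom(E (i-1), B)` is exact at `Hom(E i, B)`. -/
def HomExact (𝓑 : ObjectProperty A) (E : CochainComplex A ℤ) : Prop :=
  ∀ B : A, 𝓑 B → ∀ i : ℤ,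
    Function.Exact (fun h : E.X (i + 1) ⟶ B => E.d i (i + 1) ≫ h)
      (fun g : E.X i ⟶ B => E.d (i - 1) i ≫ g)

/-- `X` is the image of `P₀ ⟶ Q₋₁` in a `Hom(-, 𝓕)`-exact exact sequence
`⋯ ⟶ P₁ ⟶ P₀ ⟶ Q₋₁ ⟶ Q₋₂ ⟶ ⋯` with all `Pᵢ` in `𝓟` and all `Qᵢ` in `𝓠`. The sequence is
recorded as an acyclic cochain complex `E`, where `Pᵢ` is `E.X (-1 - i)` for `i ≥ 0` and `Qᵢ` is
`E.X (-1 - i)` for `i < 0`; thus `P₀ ⟶ Q₋₁` is `E.d (-1) 0`. -/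
def HasCompleteResolution (𝓟 𝓠 𝓕 : ObjectProperty A) : ObjectProperty A := fun X =>
  ∃ E : CochainComplex A ℤ,
    E.Acyclic ∧ HomExact 𝓕 E ∧ (∀ i : ℤ, i < 0 → 𝓟 (E.X i)) ∧ (∀ i : ℤ, 0 ≤ i → 𝓠 (E.X i)) ∧
      Nonempty (X ≅ image (E.d (-1) 0))

/-- There is an exact sequence `0 ⟶ Gₙ ⟶ ⋯ ⟶ G₁ ⟶ G₀ ⟶ X ⟶ 0` with all `Gᵢ` in `𝓧`. It is recorded
as an acyclic chain complex `E` in nonnegative degrees with `E.X 0 ≅ X`, with `Gᵢ = E.X (i + 1)`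
for `i ≤ n`, and with zero objects in the degrees above `n + 1`. -/
def HasResolutionOfLength (𝓧 : ObjectProperty A) (X : A) (n : ℕ) : Prop :=
  ∃ E : ChainComplex A ℕ,
    E.Acyclic ∧ Nonempty (E.X 0 ≅ X) ∧ (∀ i : ℕ, i ≤ n → 𝓧 (E.X (i + 1))) ∧
      ∀ i : ℕ, n < i → IsZero (E.X (i + 1))

/-- The `𝓧`-dimension of `X`: the least `n` such that there is an exact sequence
`0 ⟶ Gₙ ⟶ ⋯ ⟶ G₀ ⟶ X ⟶ 0` with all `Gᵢ` in `𝓧`, and `∞` if there is none. -/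
def resolutionDim (𝓧 : ObjectProperty A) (X : A) : ℕ∞ :=
  ⨅ (n : ℕ) (_ : HasResolutionOfLength 𝓧 X n), (n : ℕ∞)

/-- `0 ⟶ K ⟶ F ⟶ X ⟶ 0` is a special `𝓕`-precover of `X`: it is a short exact sequence with `F` in
`𝓕` and `Ext¹(F', K) = 0` for all `F'` in `𝓕`. -/
structure IsSpecialPrecover [HasExt.{v} A] (𝓕 : ObjectProperty A) {K F X : A} (i : K ⟶ F)
    (p : F ⟶ X) : Prop where
  zero : i ≫ p = 0
  shortExact : (ShortComplex.mk i p zero).ShortExact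
  mem : 𝓕 F
  ext_one : ∀ F' : A, 𝓕 F' → Subsingleton (Abelian.Ext F' K 1)

end Abelian

section Modules

variable (R : Type u) [CommRing R]

/-- The category of complexes of `R`-modules, `⋯ ⟶ X¹ ⟶ X⁰ ⟶ X⁻¹ ⟶ ⋯`. -/
abbrev Ch : Type (u + 1) := ChainComplex (ModuleCat.{u} R) ℤ

variable {R}

/-- Semidualizing modules. -/
structure IsSemidualizing (C : ModuleCat.{u} R) : Prop where
  /-- `C` has a degreewise finitely generated projective resolution. -/
  exists_resolution : ∃ P : ProjectiveResolution C, ∀ n : ℕ, Module.Finite R (P.complex.X n)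
  /-- The homothety map `R ⟶ Hom(C, C)` is an isomorphism. -/
  bijective_homothety : Function.Bijective (LinearMap.lsmul R C)
  /-- `Extⁱ(C, C) = 0` for all `i ≥ 1`. -/
  ext_self : ∀ i : ℕ, 1 ≤ i → Subsingleton (Abelian.Ext C C i)

/-- The class of projective modules. -/
def projMod : ObjectProperty (ModuleCat.{u} R) := fun M => Module.Projective R M

/-- The class of `C`-projective modules, i.e. the modules isomorphic to `C ⊗ P` with `P`
projective. -/
def cProjMod (C : ModuleCat.{u} R) : ObjectProperty (ModuleCat.{u} R) := fun M =>
  ∃ P : ModuleCat.{u} R, Module.Projective R P ∧ Nonempty (M ≃ₗ[R] (C ⊗[R] P))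

/-- The class of `C`-flat modules, i.e. the modules isomorphic to `C ⊗ F` with `F` flat. -/
def cFlatMod (C : ModuleCat.{u} R) : ObjectProperty (ModuleCat.{u} R) := fun M =>
  ∃ F : ModuleCat.{u} R, Module.Flat R F ∧ Nonempty (M ≃ₗ[R] (C ⊗[R] F))

/-- For a class `𝓧` of modules, the class of `𝓧`-complexes: the exact complexes all of whose cycle
modules lie in `𝓧`. -/
def tilde (𝓧 : ObjectProperty (ModuleCat.{u} R)) : ObjectProperty (Ch R) := fun X =>
  X.Acyclic ∧ ∀ i : ℤ, 𝓧 (X.cycles i)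

/-- The class of `D_C`-projective complexes. -/
def DCProjective (C : ModuleCat.{u} R) : ObjectProperty (Ch R) :=
  HasCompleteResolution (tilde projMod) (tilde (cProjMod C)) (tilde (cFlatMod C))

/-- The `D_C`-projective dimension of a complex. -/
def dcPd (C : ModuleCat.{u} R) (X : Ch R) : ℕ∞ := resolutionDim (DCProjective C) X

/-- The `𝓟_C`-projective dimension of a complex. -/
def pcPd (C : ModuleCat.{u} R) (X : Ch R) : ℕ∞ := resolutionDim (tilde (cProjMod C)) X

end Modules

end

end RelDing

/-!
The `D_C`-projective complexes form the largest class which is left `Ext`-orthogonal to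
`tilde (cFlatMod C)` and each of whose objects embeds into an object of `tilde (cProjMod C)` with
cokernel in the class. Closure under extensions and under kernels of epimorphisms therefore follows
by exhibiting a larger class with the same two properties. Given a `D_C`-projective resolution
`0 ⟶ Gₙ ⟶ ⋯ ⟶ G₀ ⟶ X ⟶ 0`, apply induction to the kernel `X₁` of `G₀ ⟶ X`: pushing `G₀` out along
an embedding `X₁ ⟶ Y₁` with `D_C`-projective cokernel and `𝓟_C-pd(Y₁) ≤ n - 1` gives the special
precover `0 ⟶ Y₁ ⟶ G ⟶ X ⟶ 0`, and dividing an embedding `G ⟶ Q` into an object of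
`tilde (cProjMod C)` by `Y₁` gives the embedding of `X`.

This rests on the vanishing of `Extⁱ(A, B)` for `A` in `tilde (cProjMod C)` and `B` in
`tilde (cFlatMod C)`. The cycles of a complex in `tilde (cProjMod C)` are `Ext`-orthogonal to one
another, so it is contractible and hence a retract of a sum of discs, whose `Ext` groups are
products of `Ext` groups of modules. There `Extⁱ(C ⊗ P, C ⊗ F) = 0`, because `C` has a resolution by
finitely generated projective modules and `Extⁱ(C, C) = 0`.
-/

open scoped ZeroObject

namespace RelDing

section ShortExactSequences

variable {A : Type u} [Category.{v} A] [Abelian A]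

/-- There is a short exact sequence `0 ⟶ X ⟶ Y ⟶ Z ⟶ 0`. Only the existence of the two maps is
recorded, so that short exact sequences can be composed at the level of objects. -/
def IsSES (X Y Z : A) : Prop :=
  ∃ (f : X ⟶ Y) (g : Y ⟶ Z) (w : f ≫ g = 0), (ShortComplex.mk f g w).ShortExact

lemma IsSES.of_shortExact {S : ShortComplex A} (hS : S.ShortExact) : IsSES S.X₁ S.X₂ S.X₃ :=
  ⟨S.f, S.g, S.zero, hS⟩

lemma isSES_op_iff {X Y Z : A} :
    IsSES (Opposite.op Z) (Opposite.op Y) (Opposite.op X) ↔ IsSES X Y Z :=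
  ⟨fun ⟨f, g, w, h⟩ => ⟨g.unop, f.unop, by rw [← unop_comp, w, unop_zero], h.unop⟩,
    fun ⟨f, g, w, h⟩ => ⟨g.op, f.op, by rw [← op_comp, w, op_zero], h.op⟩⟩

lemma IsSES.of_iso {X Y Z X' Y' Z' : A} (h : IsSES X Y Z) (e₁ : X ≅ X') (e₂ : Y ≅ Y')
    (e₃ : Z ≅ Z') : IsSES X' Y' Z' := by
  obtain ⟨f, g, w, h⟩ := h
  refine ⟨e₁.inv ≫ f ≫ e₂.hom, e₂.inv ≫ g ≫ e₃.hom, by simp [reassoc_of% w], ?_⟩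
  refine ShortComplex.shortExact_of_iso (ShortComplex.isoMk e₁ e₂ e₃ ?_ ?_) h <;> simp

lemma isSES_of_isZero_right {X Z : A} (hZ : IsZero Z) : IsSES X X Z :=
  .of_shortExact (ShortComplex.Splitting.ofIsIsoOfIsZero
    (.mk (𝟙 X) (0 : X ⟶ Z) comp_zero) (inferInstanceAs (IsIso (𝟙 X))) hZ).shortExact

lemma isSES_of_isZero_left {X Z : A} (hZ : IsZero Z) : IsSES Z X X :=
  .of_shortExact (ShortComplex.Splitting.ofIsZeroOfIsIso
    (.mk (0 : Z ⟶ X) (𝟙 X) zero_comp) hZ (inferInstanceAs (IsIso (𝟙 X)))).shortExact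

lemma IsSES.nonempty_iso_of_isZero_left {X Y Z : A} (h : IsSES X Y Z) (hX : IsZero X) :
    Nonempty (Y ≅ Z) := by
  obtain ⟨f, g, w, h⟩ := h
  have : IsIso g := h.isIso_g_iff.2 hX
  exact ⟨asIso g⟩

lemma isSES_kernel_of_epi {X Y : A} (f : X ⟶ Y) [Epi f] : IsSES (kernel f) X Y :=
  .of_shortExact (.mk' (ShortComplex.kernelSequence_exact f) inferInstance ‹Epi f›)

lemma shortExact_biprodMap {S T : ShortComplex A} (hS : S.ShortExact) (hT : T.ShortExact) :
    (ShortComplex.mk (biprod.map S.f T.f) (biprod.map S.g T.g) (by ext <;> simp)).ShortExact := by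
  have := hS.mono_f
  have := hS.epi_g
  have := hT.mono_f
  have := hT.epi_g
  refine .mk' (ShortComplex.exact_of_g_is_cokernel _
    (CokernelCofork.IsColimit.ofπ' _ _ fun {W} k hk => ?_))
    (inferInstanceAs (Mono (biprod.map S.f T.f))) (inferInstanceAs (Epi (biprod.map S.g T.g)))
  have hk₁ : S.f ≫ biprod.inl ≫ k = 0 := by simpa using biprod.inl ≫= hk
  have hk₂ : T.f ≫ biprod.inr ≫ k = 0 := by simpa using biprod.inr ≫= hk
  exact ⟨biprod.desc (hS.exact.desc _ hk₁) (hT.exact.desc _ hk₂), by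
    ext <;> simp [hS.exact.g_desc, hT.exact.g_desc]⟩

lemma IsSES.biprod {X Y Z X' Y' Z' : A} (h : IsSES X Y Z) (h' : IsSES X' Y' Z') :
    IsSES (X ⊞ X') (Y ⊞ Y') (Z ⊞ Z') := by
  obtain ⟨f, g, w, h⟩ := h
  obtain ⟨f', g', w', h'⟩ := h'
  exact .of_shortExact (shortExact_biprodMap h h')

lemma isSES_of_isPushout {X Y Z W D : A} {t : X ⟶ Y} {l : X ⟶ Z} {r : Y ⟶ W} {b : Z ⟶ W}
    (sq : IsPushout t l r b) {p : Y ⟶ D} {w : t ≫ p = 0}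
    (h : (ShortComplex.mk t p w).ShortExact) : IsSES Z W D := by
  have : Mono t := h.mono_f
  have : Epi p := h.epi_g
  let q : W ⟶ D := sq.desc p 0 (by rw [w, comp_zero])
  have hr : r ≫ q = p := sq.inl_desc _ _ _
  have hb : b ≫ q = 0 := sq.inr_desc _ _ _
  have : Mono b := MorphismProperty.of_isPushout (P := .monomorphisms A) sq.flip ‹Mono t›
  have : Epi q := epi_of_epi_fac hr
  refine .of_shortExact (S := .mk b q hb) (.mk' (ShortComplex.exact_of_g_is_cokernel _
    (CokernelCofork.IsColimit.ofπ' _ _ fun {T} k (hk : b ≫ k = 0) => ?_)) ‹_› ‹_›)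
  have hrk : t ≫ r ≫ k = 0 := by rw [sq.w_assoc, hk, comp_zero]
  have hp : p ≫ h.exact.desc (r ≫ k) hrk = r ≫ k := h.exact.g_desc _ _
  exact ⟨h.exact.desc (r ≫ k) hrk, sq.hom_ext (by simp [reassoc_of% hr, hp])
    (by simp [reassoc_of% hb, hk])⟩

lemma IsSES.pushout {X Y Z W D : A} (hY : IsSES X Y Z) (hW : IsSES X W D) :
    ∃ E, IsSES W E Z ∧ IsSES Y E D := by
  obtain ⟨f, g, w, hY⟩ := hY
  obtain ⟨f', g', w', hW⟩ := hW
  have sq := IsPushout.of_hasPushout f f'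
  exact ⟨_, isSES_of_isPushout sq hY, isSES_of_isPushout sq.flip hW⟩

/-- The third isomorphism theorem, where `L` is the cokernel of `X ⟶ Y ⟶ E`. -/
lemma IsSES.cokernel_comp {X Y Z E D : A} (h : IsSES X Y Z) (h' : IsSES Y E D) :
    ∃ L, IsSES X E L ∧ IsSES Z L D := by
  obtain ⟨f, g, w, h⟩ := h
  obtain ⟨f', g', w', h'⟩ := h'
  have : Mono f := h.mono_f
  have : Mono f' := h'.mono_f
  have : Epi g := h.epi_g
  have sq := IsPushout.of_hasPushout f' g
  have hL : (f ≫ f') ≫ pushout.inl f' g = 0 := by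
    rw [Category.assoc, sq.w, reassoc_of% w, zero_comp]
  refine ⟨_, .of_shortExact (S := .mk _ _ hL) (.mk' (ShortComplex.exact_of_g_is_cokernel _
    (CokernelCofork.IsColimit.ofπ' _ _ fun {T} k (hk : (f ≫ f') ≫ k = 0) => ?_))
    (inferInstanceAs (Mono (f ≫ f'))) (inferInstanceAs (Epi (pushout.inl f' g)))),
    isSES_of_isPushout sq h'⟩
  rw [Category.assoc] at hk
  exact ⟨sq.desc k (h.exact.desc (f' ≫ k) hk) (h.exact.g_desc (f' ≫ k) hk).symm,
    sq.inl_desc _ _ _⟩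

lemma IsSES.kernel_comp {K Q Y X G : A} (h : IsSES K Q Y) (h' : IsSES X Y G) :
    ∃ W, IsSES K W X ∧ IsSES W Q G := by
  obtain ⟨L, hL, hL'⟩ := (isSES_op_iff.2 h').cokernel_comp (isSES_op_iff.2 h)
  exact ⟨L.unop, isSES_op_iff.1 hL', isSES_op_iff.1 hL⟩

lemma exists_shortExact_projective [EnoughProjectives A] (X : A) :
    ∃ S : ShortComplex A, S.ShortExact ∧ Projective S.X₂ ∧ S.X₃ = X :=
  ⟨.mk (kernel.ι (Projective.π X)) (Projective.π X) (kernel.condition _),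
    .mk' (ShortComplex.kernelSequence_exact _) inferInstance inferInstance, inferInstance, rfl⟩

end ShortExactSequences

section ExtOrthogonality

open Abelian

variable {A : Type u} [Category.{v} A] [Abelian A] [HasExt.{v} A]

/-- `Extⁿ(X, H) = 0` for all `n ≥ 1`. -/
def ExtOrtho (X H : A) : Prop := ∀ n : ℕ, Subsingleton (Ext X H (n + 1))

/-- The class of objects `X` such that `Extⁿ(X, H) = 0` for all `n ≥ 1` and all `H` in `𝓕`. -/
def leftExtOrthogonal (𝓕 : ObjectProperty A) : ObjectProperty A := fun X => ∀ H, 𝓕 H → ExtOrtho X H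

lemma extOrtho_iff {X H : A} : ExtOrtho X H ↔ ∀ (n : ℕ) (x : Ext X H (n + 1)), x = 0 :=
  forall_congr' fun _ => subsingleton_iff_forall_eq 0

lemma extOrtho_of_projective (X H : A) [Projective X] : ExtOrtho X H :=
  fun n => Ext.subsingleton_of_projective X H n

lemma ExtOrtho.of_retract_left {X Y H : A} (h : ExtOrtho Y H) (r : Retract X Y) :
    ExtOrtho X H := by
  rw [extOrtho_iff] at h ⊢
  intro n x
  rw [← Ext.mk₀_id_comp x, ← r.retract, ← Ext.mk₀_comp_mk₀_assoc,
    h n ((Ext.mk₀ r.r).comp x (zero_add _)), Ext.comp_zero]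

lemma ExtOrtho.of_iso_left {X Y H : A} (h : ExtOrtho Y H) (e : X ≅ Y) : ExtOrtho X H :=
  h.of_retract_left e.retract

lemma ExtOrtho.of_iso_right {X H H' : A} (h : ExtOrtho X H) (e : H ≅ H') : ExtOrtho X H' := by
  rw [extOrtho_iff] at h ⊢
  intro n x
  rw [← Ext.comp_mk₀_id x, ← e.inv_hom_id, ← Ext.mk₀_comp_mk₀,
    ← Ext.comp_assoc_of_third_deg_zero, h n (x.comp (Ext.mk₀ e.inv) _), Ext.zero_comp]

lemma IsSES.extOrtho_left₁ {X Y Z H : A} (h : IsSES X Y Z) (hY : ExtOrtho Y H)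
    (hZ : ExtOrtho Z H) : ExtOrtho X H := by
  obtain ⟨f, g, w, h⟩ := h
  rw [extOrtho_iff] at *
  intro n x
  obtain ⟨y, rfl⟩ := Ext.contravariant_sequence_exact₁ h H x (add_comm 1 (n + 1)) (hZ _ _)
  rw [hY n y, Ext.comp_zero]

lemma IsSES.extOrtho_left₂ {X Y Z H : A} (h : IsSES X Y Z) (hX : ExtOrtho X H)
    (hZ : ExtOrtho Z H) : ExtOrtho Y H := by
  obtain ⟨f, g, w, h⟩ := h
  rw [extOrtho_iff] at *
  intro n x
  obtain ⟨y, rfl⟩ := Ext.contravariant_sequence_exact₂ h H x (hX n _)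
  rw [hZ n y, Ext.comp_zero]

lemma IsSES.extOrtho_right₂ {X Y Z T : A} (h : IsSES X Y Z) (hX : ExtOrtho T X)
    (hZ : ExtOrtho T Z) : ExtOrtho T Y := by
  obtain ⟨f, g, w, h⟩ := h
  rw [extOrtho_iff] at *
  intro n x
  obtain ⟨y, rfl⟩ := Ext.covariant_sequence_exact₂ T h x (hZ n _)
  rw [hX n y, Ext.zero_comp]

lemma IsSES.extOrtho_right₃ {X Y Z T : A} (h : IsSES X Y Z) (hX : ExtOrtho T X)
    (hY : ExtOrtho T Y) : ExtOrtho T Z := by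
  obtain ⟨f, g, w, h⟩ := h
  rw [extOrtho_iff] at *
  intro n x
  obtain ⟨y, rfl⟩ := Ext.covariant_sequence_exact₃ T h x rfl (hX _ _)
  rw [hY n y, Ext.zero_comp]

variable {S : ShortComplex A} (hS : S.ShortExact) {H : A}
include hS

lemma exists_extension_of_subsingleton_ext_one (h : Subsingleton (Ext S.X₃ H 1)) (k : S.X₁ ⟶ H) :
    ∃ l : S.X₂ ⟶ H, S.f ≫ l = k := by
  obtain ⟨y, hy⟩ := Ext.contravariant_sequence_exact₁ hS H (Ext.mk₀ k) (add_zero 1) (h.elim _ _)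
  obtain ⟨l, rfl⟩ := (Ext.mk₀_bijective _ _).2 y
  exact ⟨l, (Ext.mk₀_bijective _ _).1 (by rw [← hy, Ext.mk₀_comp_mk₀])⟩

lemma subsingleton_ext_one_of_exists_extension (h : Subsingleton (Ext S.X₂ H 1))
    (hf : ∀ k : S.X₁ ⟶ H, ∃ l : S.X₂ ⟶ H, S.f ≫ l = k) : Subsingleton (Ext S.X₃ H 1) := by
  refine (subsingleton_iff_forall_eq 0).2 fun x => ?_
  obtain ⟨y, rfl⟩ := Ext.contravariant_sequence_exact₃ hS H x (h.elim _ _) (add_zero 1)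
  obtain ⟨k, rfl⟩ := (Ext.mk₀_bijective _ _).2 y
  obtain ⟨l, rfl⟩ := hf k
  rw [← Ext.mk₀_comp_mk₀]
  exact hS.extClass_comp_assoc _

lemma subsingleton_ext_succ_of_subsingleton {n : ℕ} (h₁ : Subsingleton (Ext S.X₁ H n))
    (h₂ : Subsingleton (Ext S.X₂ H (n + 1))) : Subsingleton (Ext S.X₃ H (n + 1)) := by
  refine (subsingleton_iff_forall_eq 0).2 fun x => ?_
  obtain ⟨y, rfl⟩ := Ext.contravariant_sequence_exact₃ hS H x (h₂.elim _ _) (add_comm 1 n)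
  rw [h₁.elim y 0, Ext.comp_zero]

lemma nonempty_iso_biprod_of_subsingleton_ext_one (h : Subsingleton (Ext S.X₃ S.X₁ 1)) :
    Nonempty (S.X₂ ≅ S.X₁ ⊞ S.X₃) := by
  obtain ⟨r, hr⟩ := exists_extension_of_subsingleton_ext_one hS h (𝟙 S.X₁)
  have := hS.epi_g
  exact ⟨(ShortComplex.Splitting.ofExactOfRetraction S hS.exact r hr hS.epi_g).isoBinaryBiproduct⟩

omit hS

lemma extOrtho_of_exists_syzygy {𝓦 : ObjectProperty A}
    (h𝓦 : ∀ W, 𝓦 W → ∃ S : ShortComplex A, S.ShortExact ∧ S.X₃ = W ∧ 𝓦 S.X₁ ∧ ExtOrtho S.X₂ H ∧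
      ∀ k : S.X₁ ⟶ H, ∃ l : S.X₂ ⟶ H, S.f ≫ l = k) {W : A} (hW : 𝓦 W) : ExtOrtho W H := by
  intro n
  induction n generalizing W with
  | zero =>
    obtain ⟨S, hS, rfl, -, hS₂, hf⟩ := h𝓦 W hW
    exact subsingleton_ext_one_of_exists_extension hS (hS₂ 0) hf
  | succ n ih =>
    obtain ⟨S, hS, rfl, hS₁, hS₂, -⟩ := h𝓦 W hW
    exact subsingleton_ext_succ_of_subsingleton hS (ih hS₁) (hS₂ (n + 1))

/-- The pushout of `Y` along `X ⟶ I` is an extension of `Z` by `I`, which splits because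
`Ext¹(Z, I) = 0`. -/
lemma IsSES.horseshoe {X Y Z I X' J Z' : A} (h : IsSES X Y Z) (hX : IsSES X I X')
    (hZ : IsSES Z J Z') (hI : Subsingleton (Ext Z I 1)) :
    ∃ Y', IsSES Y (I ⊞ J) Y' ∧ IsSES X' Y' Z' := by
  obtain ⟨E, ⟨f, g, w, hE⟩, hYE⟩ := h.pushout hX
  obtain ⟨e⟩ := nonempty_iso_biprod_of_subsingleton_ext_one hE hI
  have hEIJ : IsSES E (I ⊞ J) Z' :=
    ((isSES_of_isZero_right (isZero_zero A)).biprod hZ).of_iso e.symm (Iso.refl _)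
      (isoZeroBiprod (isZero_zero A)).symm
  exact hYE.cokernel_comp hEIJ

end ExtOrthogonality

section Splicing

variable {A : Type u} [Category.{v} A] [Abelian A] {ι : Type*} {c : ComplexShape ι}
  (K : HomologicalComplex A c)

lemma shortExact_cycles {i j : ι} (hij : c.Rel i j) (hj : K.ExactAt j) :
    (ShortComplex.mk (K.iCycles i) (K.toCycles i j)
      (by simp [← cancel_mono (K.iCycles j)])).ShortExact := by
  have : Epi (K.toCycles i j) := by
    obtain rfl := c.prev_eq' hij
    exact hj.epi_toCycles
  refine .mk' (ShortComplex.exact_of_f_is_kernel _ (KernelFork.IsLimit.ofι' _ _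
    fun {T} (k : T ⟶ K.X i) (hk : k ≫ K.toCycles i j = 0) => ?_))
    (inferInstanceAs (Mono (K.iCycles i))) this
  have hk' : k ≫ K.d i j = 0 := by rw [← K.toCycles_i i j, reassoc_of% hk, zero_comp]
  exact ⟨K.liftCycles k j (c.next_eq' hij) hk', K.liftCycles_i _ _ _ _⟩

lemma isSES_cycles {i j : ι} (hij : c.Rel i j) (hj : K.ExactAt j) :
    IsSES (K.cycles i) (K.X i) (K.cycles j) :=
  .of_shortExact (shortExact_cycles K hij hj)

lemma exactAt_of_fac {i j k : ι} (hij : c.Rel i j) (hjk : c.Rel j k) {Z Z' : A} {f : Z ⟶ K.X j}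
    {g : K.X j ⟶ Z'} {w : f ≫ g = 0} (h : (ShortComplex.mk f g w).ShortExact) (p : K.X i ⟶ Z)
    [Epi p] (m : Z' ⟶ K.X k) [Mono m] (hp : p ≫ f = K.d i j) (hm : g ≫ m = K.d j k) :
    K.ExactAt j := by
  have hpg : K.d i j ≫ g = 0 := by rw [← hp, Category.assoc, w, comp_zero]
  have h₁ : (ShortComplex.mk (K.d i j) g hpg).Exact :=
    (ShortComplex.exact_iff_of_epi_of_isIso_of_mono (S₂ := .mk f g w)
      { τ₁ := p, τ₂ := 𝟙 (K.X j), τ₃ := 𝟙 Z', comm₁₂ := by simp [hp] }).2 h.exact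
  exact (K.exactAt_iff' i j k (c.prev_eq' hij) (c.next_eq' hjk)).2
    ((ShortComplex.exact_iff_of_epi_of_isIso_of_mono
      (S₁ := .mk (K.d i j) g hpg) (S₂ := .mk (K.d i j) (K.d j k) (K.d_comp_d i j k))
      { τ₁ := 𝟙 (K.X i), τ₂ := 𝟙 (K.X j), τ₃ := m, comm₂₃ := by simp [hm] }).1 h₁)

end Splicing

section Resolutions

variable {A : Type u} [Category.{v} A] [Abelian A] {𝓧 𝓨 : ObjectProperty A}

/-- `IsResolved 𝓧 n X` is an inductive form of `HasResolutionOfLength 𝓧 X n`, in which the exact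
sequence `0 ⟶ Gₙ ⟶ ⋯ ⟶ G₀ ⟶ X ⟶ 0` is broken up into short exact sequences. -/
def IsResolved (𝓧 : ObjectProperty A) : ℕ → ObjectProperty A
  | 0 => 𝓧.isoClosure
  | n + 1 => fun X => ∃ G K, 𝓧 G ∧ IsSES K G X ∧ IsResolved 𝓧 n K

lemma IsResolved.of_iso {n : ℕ} {X Y : A} (h : IsResolved 𝓧 n X) (e : X ≅ Y) :
    IsResolved 𝓧 n Y := by
  cases n with
  | zero => exact 𝓧.isoClosure.prop_of_iso e h
  | succ n =>
    obtain ⟨G, K, hG, hK, h⟩ := h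
    exact ⟨G, K, hG, hK.of_iso (Iso.refl _) (Iso.refl _) e, h⟩

lemma IsResolved.mono (h𝓧 : 𝓧 ≤ 𝓨) {n : ℕ} {X : A} (h : IsResolved 𝓧 n X) :
    IsResolved 𝓨 n X := by
  induction n generalizing X with
  | zero => exact ObjectProperty.monotone_isoClosure h𝓧 X h
  | succ n ih =>
    obtain ⟨G, K, hG, hK, h⟩ := h
    exact ⟨G, K, h𝓧 _ hG, hK, ih h⟩

lemma IsResolved.exists_sequence {n : ℕ} {X : A} (h : IsResolved 𝓧 n X) :
    ∃ K G : ℕ → A, K 0 = X ∧ (∀ i, IsSES (K (i + 1)) (G i) (K i)) ∧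
      (∀ i, i ≤ n → 𝓧 (G i)) ∧ ∀ i, n < i → IsZero (G i) := by
  induction n generalizing X with
  | zero =>
    obtain ⟨G, hG, ⟨e⟩⟩ := h
    refine ⟨fun | 0 => X | _ + 1 => 0, fun | 0 => G | _ + 1 => 0, rfl, ?_, ?_, ?_⟩
    · rintro (_ | i)
      · exact (isSES_of_isZero_left (isZero_zero A)).of_iso (Iso.refl _) (Iso.refl _) e.symm
      · exact isSES_of_isZero_left (isZero_zero A)
    · rintro (_ | i) hi
      exacts [hG, by lia]
    · rintro (_ | i) hi
      exacts [by lia, isZero_zero A]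
  | succ n ih =>
    obtain ⟨G₀, K₀, hG₀, hS, h⟩ := h
    obtain ⟨K, G, rfl, hK, hG, hG'⟩ := ih h
    refine ⟨fun | 0 => X | i + 1 => K i, fun | 0 => G₀ | i + 1 => G i, rfl, ?_, ?_, ?_⟩
    · rintro (_ | i)
      exacts [hS, hK i]
    · rintro (_ | i) hi
      exacts [hG₀, hG i (by lia)]
    · rintro (_ | i) hi
      exacts [by lia, hG' i (by lia)]

lemma exists_acyclic_chainComplex_of_isSES {K G : ℕ → A}
    (h : ∀ i, IsSES (K (i + 1)) (G i) (K i)) :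
    ∃ E : ChainComplex A ℕ, E.Acyclic ∧ E.X 0 = K 0 ∧ ∀ i, E.X (i + 1) = G i := by
  choose f p w hfp using h
  let Y : ℕ → A | 0 => K 0 | i + 1 => G i
  let m : ∀ i, K i ⟶ Y i | 0 => 𝟙 (K 0) | i + 1 => f i
  have hm (i) : Mono (m i) := by
    cases i
    exacts [inferInstanceAs (Mono (𝟙 (K 0))), (hfp _).mono_f]
  have hp (i) : Epi (p i) := (hfp i).epi_g
  let d (i) : Y (i + 1) ⟶ Y i := p i ≫ m i
  let E : ChainComplex A ℕ := .of Y d fun i => by simp [d, m, reassoc_of% (w i)]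
  have hd (i) : E.d (i + 1) i = p i ≫ m i := ChainComplex.of_d _ d i
  refine ⟨E, ?_, rfl, fun _ => rfl⟩
  rintro (_ | i)
  · rw [E.exactAt_iff' 1 0 0 (by simp) (by simp),
      ShortComplex.exact_iff_epi (E.sc' 1 0 0) (E.shape 0 0 (by simp))]
    change Epi (E.d 1 0)
    rw [hd 0]
    exact epi_comp' (hp 0) (inferInstanceAs (Epi (𝟙 (K 0))))
  · exact exactAt_of_fac E (i := i + 2) (k := i) (by simp) (by simp) (hfp i) (p (i + 1)) (m i)
      (hd (i + 1)).symm (hd i).symm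

lemma hasResolutionOfLength_iff {n : ℕ} {X : A} :
    HasResolutionOfLength 𝓧 X n ↔ IsResolved 𝓧 n X := by
  constructor
  · rintro ⟨E, hE, ⟨e⟩, hE₁, hE₂⟩
    have hS (i : ℕ) : IsSES (E.cycles (i + 1)) (E.X (i + 1)) (E.cycles i) :=
      isSES_cycles E (by simp) (hE i)
    have hcycles (k i : ℕ) (hi : i + k = n) : IsResolved 𝓧 k (E.cycles i) := by
      induction k generalizing i with
      | zero =>
        have := (shortExact_cycles E (i := i + 2) (j := i + 1) (by simp) (hE _)).epi_g
        have hzero : IsZero (E.cycles (i + 1)) :=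
          (hE₂ (i + 1) (by lia)).of_epi (E.toCycles (i + 2) (i + 1))
        exact ⟨_, hE₁ i (by lia), ((hS i).nonempty_iso_of_isZero_left hzero).map Iso.symm⟩
      | succ k ih => exact ⟨_, _, hE₁ i (by lia), hS i, ih _ (by lia)⟩
    have : IsIso (E.iCycles 0) := E.isIso_iCycles 0 0 (by simp) (by simp)
    exact (hcycles n 0 (by lia)).of_iso (asIso (E.iCycles 0) ≪≫ e)
  · intro h
    obtain ⟨K, G, rfl, hS, hG, hG'⟩ := h.exists_sequence
    obtain ⟨E, hE, hE₀, hEG⟩ := exists_acyclic_chainComplex_of_isSES hS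
    exact ⟨E, hE, ⟨eqToIso hE₀⟩, fun i hi => hEG i ▸ hG i hi, fun i hi => hEG i ▸ hG' i hi⟩

lemma resolutionDim_eq_iff {n : ℕ} {X : A} :
    resolutionDim 𝓧 X = n ↔ IsLeast {m | IsResolved 𝓧 m X} n := by
  simp only [resolutionDim, hasResolutionOfLength_iff]
  change ⨅ m ∈ {m | IsResolved 𝓧 m X}, (m : ℕ∞) = n ↔ _
  rcases {m | IsResolved 𝓧 m X}.eq_empty_or_nonempty with hS | hS
  · simp [hS, IsLeast]
  · rw [← ENat.natCast_sInf hS, Nat.cast_inj]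
    exact ⟨fun h => h ▸ ⟨Nat.sInf_mem hS, fun _ => Nat.sInf_le⟩, IsLeast.csInf_eq⟩

end Resolutions

lemma exists_int_sequence {α : Type*} {t s : α → Prop} {r l : α → α → Prop} (hts : ∀ x, t x → s x)
    (hr : ∀ x, t x → ∃ y, t y ∧ r x y) (hl : ∀ x, s x → ∃ y, s y ∧ l y x) {x : α} (hx : t x) :
    ∃ K : ℤ → α, K 0 = x ∧ (∀ i, s (K i)) ∧ (∀ i, 0 ≤ i → r (K i) (K (i + 1))) ∧
      ∀ i, i < 0 → l (K i) (K (i + 1)) := by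
  choose! f hft hf using hr
  choose! g hgs hg using hl
  have hR (n : ℕ) : t (f^[n] x) := by
    induction n with
    | zero => exact hx
    | succ n ih => exact Function.iterate_succ_apply' f n x ▸ hft _ ih
  have hL (n : ℕ) : s (g^[n] x) := by
    induction n with
    | zero => exact hts x hx
    | succ n ih => exact Function.iterate_succ_apply' g n x ▸ hgs _ ih
  have hr (n : ℕ) : r (f^[n] x) (f^[n + 1] x) :=
    Function.iterate_succ_apply' f n x ▸ hf _ (hR n)
  have hl (n : ℕ) : l (g^[n + 1] x) (g^[n] x) :=
    Function.iterate_succ_apply' g n x ▸ hg _ (hL n)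
  refine ⟨fun | .ofNat n => f^[n] x | .negSucc n => g^[n + 1] x, rfl, ?_, ?_, ?_⟩
  · rintro (n | n)
    exacts [hts _ (hR n), hL (n + 1)]
  · rintro (n | n) hi
    exacts [hr n, by lia]
  · rintro (n | _ | n) hi
    exacts [absurd hi (by simp), hl 0, hl (n + 1)]

section CompleteResolutions

variable {A : Type u} [Category.{v} A] [Abelian A]

lemma exists_acyclic_cochainComplex_of_isSES {K Y : ℤ → A}
    (h : ∀ i, IsSES (K i) (Y i) (K (i + 1))) :
    ∃ E : CochainComplex A ℤ, E.Acyclic ∧ E.X = Y ∧ ∀ i, Nonempty (E.cycles i ≅ K i) := by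
  choose m p w hmp using h
  have hm (i) : Mono (m i) := (hmp i).mono_f
  have hp (i) : Epi (p i) := (hmp i).epi_g
  let d (i) : Y i ⟶ Y (i + 1) := p i ≫ m (i + 1)
  let E : CochainComplex A ℤ := .of Y d fun i => by simp [d, reassoc_of% (w (i + 1))]
  have hd (i) : E.d i (i + 1) = p i ≫ m (i + 1) := CochainComplex.of_d _ d i
  refine ⟨E, fun j => ?_, rfl, fun i => ?_⟩
  · obtain ⟨i, rfl⟩ : ∃ i, j = i + 1 := ⟨j - 1, by lia⟩
    exact exactAt_of_fac E (by simp) (by simp) (hmp (i + 1)) (p i) (m (i + 1 + 1)) (hd i).symm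
      (hd (i + 1)).symm
  · exact ⟨(E.cyclesIsKernel i (i + 1) (by simp)).conePointUniqueUpToIso
      (isKernelCompMono (hmp i).fIsKernel (m (i + 1)) (hd i))⟩

lemma nonempty_image_d_iso_cycles {ι : Type*} {c : ComplexShape ι} (K : HomologicalComplex A c)
    {i j : ι} (hij : c.Rel i j) (hj : K.ExactAt j) : Nonempty (image (K.d i j) ≅ K.cycles j) := by
  have : Epi (K.toCycles i j) := (shortExact_cycles K hij hj).epi_g
  have := strongEpi_of_epi (K.toCycles i j)
  exact ⟨(image.isoStrongEpiMono _ _ (K.toCycles_i i j)).symm⟩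

lemma homExact_iff_exists_extension {E : CochainComplex A ℤ} (hE : E.Acyclic)
    {𝓕 : ObjectProperty A} : HomExact 𝓕 E ↔ ∀ H, 𝓕 H → ∀ (i : ℤ) (k : E.cycles i ⟶ H),
      ∃ l : E.X i ⟶ H, E.iCycles i ≫ l = k := by
  have hS (i : ℤ) := shortExact_cycles E (i := i) (j := i + 1) (by simp) (hE _)
  have hepi (i : ℤ) : Epi (E.toCycles i (i + 1)) := (hS i).epi_g
  refine forall₂_congr fun H _ => ⟨fun h j k => ?_, fun h j => ?_⟩
  · obtain ⟨i, rfl⟩ : ∃ i, j = i + 1 := ⟨j - 1, by lia⟩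
    have hd : E.d (i - 1) i ≫ E.toCycles i (i + 1) = 0 := by simp
    obtain ⟨l, hl : E.d i (i + 1) ≫ l = _⟩ := (h i (E.toCycles i (i + 1) ≫ k)).1
      (by dsimp only; rw [reassoc_of% hd, zero_comp])
    exact ⟨l, by rw [← cancel_epi (E.toCycles i (i + 1)), ← hl, E.toCycles_i_assoc]⟩
  · generalize hi : j - 1 = i
    obtain rfl : j = i + 1 := by lia
    refine fun g => ⟨fun (hg : E.d i (i + 1) ≫ g = 0) => ?_, fun ⟨l, hl⟩ => by simp [← hl]⟩
    have hg' : E.iCycles (i + 1) ≫ g = 0 := by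
      rw [← cancel_epi (E.toCycles i (i + 1)), E.toCycles_i_assoc, hg, comp_zero]
    obtain ⟨l, hl⟩ := h _ ((hS (i + 1)).exact.desc g hg')
    have hdesc : E.toCycles (i + 1) (i + 1 + 1) ≫ (hS (i + 1)).exact.desc g hg' = g :=
      (hS (i + 1)).exact.g_desc g hg'
    have hdl : E.d (i + 1) (i + 1 + 1) ≫ l = g := by rw [← E.toCycles_i_assoc, hl, hdesc]
    exact ⟨l, hdl⟩

variable [HasExt.{v} A]

lemma homExact_iff_forall_cycles {E : CochainComplex A ℤ} (hE : E.Acyclic) {𝓕 : ObjectProperty A}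
    (hX : ∀ i, leftExtOrthogonal 𝓕 (E.X i)) :
    HomExact 𝓕 E ↔ ∀ i, leftExtOrthogonal 𝓕 (E.cycles i) := by
  have hS (i : ℤ) := shortExact_cycles E (i := i) (j := i + 1) (by simp) (hE _)
  rw [homExact_iff_exists_extension hE]
  refine ⟨fun h i H hH => ?_, fun h H hH i => exists_extension_of_subsingleton_ext_one (hS i)
    (h (i + 1) H hH 0)⟩
  refine extOrtho_of_exists_syzygy (𝓦 := fun W => ∃ i, W = E.cycles i) ?_ ⟨i, rfl⟩
  rintro W ⟨j, rfl⟩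
  obtain ⟨i, rfl⟩ : ∃ i, j = i + 1 := ⟨j - 1, by lia⟩
  exact ⟨_, hS i, rfl, ⟨i, rfl⟩, hX i H hH, h H hH i⟩

/-- `𝓧` is a class of objects which are `Ext`-orthogonal to `𝓕` and each of which embeds into an
object of `𝓠` with cokernel in `𝓧`. -/
structure IsCosyzygyClosed (𝓠 𝓕 𝓧 : ObjectProperty A) : Prop where
  le : 𝓧 ≤ leftExtOrthogonal 𝓕
  exists_cosyzygy : ∀ X, 𝓧 X → ∃ Q Y, 𝓠 Q ∧ 𝓧 Y ∧ IsSES X Q Y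

/-- The largest class `𝓧` such that `IsCosyzygyClosed 𝓠 𝓕 𝓧`. It consists of the objects with a
`Hom(-, 𝓕)`-exact complete resolution, see `hasCompleteResolution_eq_cosyzygyClass`. -/
def cosyzygyClass (𝓠 𝓕 : ObjectProperty A) : ObjectProperty A := fun X =>
  ∃ 𝓧, IsCosyzygyClosed 𝓠 𝓕 𝓧 ∧ 𝓧 X

variable {𝓟 𝓠 𝓕 𝓧 : ObjectProperty A}

lemma isCosyzygyClosed_cosyzygyClass (𝓠 𝓕 : ObjectProperty A) :
    IsCosyzygyClosed 𝓠 𝓕 (cosyzygyClass 𝓠 𝓕) where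
  le _ := fun ⟨_, h𝓧, hX⟩ => h𝓧.le _ hX
  exists_cosyzygy X := fun ⟨𝓧, h𝓧, hX⟩ =>
    let ⟨Q, Y, hQ, hY, h⟩ := h𝓧.exists_cosyzygy X hX
    ⟨Q, Y, hQ, ⟨𝓧, h𝓧, hY⟩, h⟩

lemma IsCosyzygyClosed.anti {𝓖 : ObjectProperty A} (h𝓧 : IsCosyzygyClosed 𝓠 𝓕 𝓧) (h : 𝓖 ≤ 𝓕) :
    IsCosyzygyClosed 𝓠 𝓖 𝓧 :=
  ⟨fun X hX H hH => h𝓧.le X hX H (h H hH), h𝓧.exists_cosyzygy⟩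

lemma IsCosyzygyClosed.le_cosyzygyClass (h𝓧 : IsCosyzygyClosed 𝓠 𝓕 𝓧) : 𝓧 ≤ cosyzygyClass 𝓠 𝓕 :=
  fun _ hX => ⟨𝓧, h𝓧, hX⟩

lemma IsCosyzygyClosed.le_hasCompleteResolution (hP : 𝓟 ≤ leftExtOrthogonal 𝓕)
    (hPX : ∀ X, ∃ P K, 𝓟 P ∧ IsSES K P X) (h𝓧 : IsCosyzygyClosed 𝓠 𝓕 𝓧) :
    𝓧 ≤ HasCompleteResolution 𝓟 𝓠 𝓕 := by
  intro X hX
  obtain ⟨K, rfl, hK, hK𝓠, hK𝓟⟩ := exists_int_sequence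
    (r := fun X Y => ∃ Q, 𝓠 Q ∧ IsSES X Q Y) (l := fun K X => ∃ P, 𝓟 P ∧ IsSES K P X) h𝓧.le
    (fun Y hY => let ⟨Q, Z, hQ, hZ, h⟩ := h𝓧.exists_cosyzygy Y hY; ⟨Z, hZ, Q, hQ, h⟩)
    (fun Y hY => let ⟨P, K, hPK, h⟩ := hPX Y
      ⟨K, fun H hH => h.extOrtho_left₁ (hP _ hPK H hH) (hY H hH), P, hPK, h⟩) hX
  have hY (i : ℤ) : ∃ Y, IsSES (K i) Y (K (i + 1)) ∧ (i < 0 → 𝓟 Y) ∧ (0 ≤ i → 𝓠 Y) := by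
    rcases lt_or_ge i 0 with hi | hi
    · obtain ⟨Y, hY, hS⟩ := hK𝓟 i hi
      exact ⟨Y, hS, fun _ => hY, fun h => absurd hi h.not_gt⟩
    · obtain ⟨Y, hY, hS⟩ := hK𝓠 i hi
      exact ⟨Y, hS, fun h => absurd h hi.not_gt, fun _ => hY⟩
  choose Y hS hY𝓟 hY𝓠 using hY
  obtain ⟨E, hE, rfl, hEK⟩ := exists_acyclic_cochainComplex_of_isSES hS
  have hEO (i : ℤ) : leftExtOrthogonal 𝓕 (E.X i) := fun H hH =>
    (hS i).extOrtho_left₂ (hK i H hH) (hK (i + 1) H hH)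
  refine ⟨E, hE, (homExact_iff_forall_cycles hE hEO).2 fun i H hH => ?_, hY𝓟, hY𝓠,
    ⟨(hEK 0).some.symm ≪≫ (nonempty_image_d_iso_cycles E (by simp) (hE 0)).some.symm⟩⟩
  exact (hK i H hH).of_iso_left (hEK i).some

lemma hasCompleteResolution_le_cosyzygyClass (hP : 𝓟 ≤ leftExtOrthogonal 𝓕)
    (hQ : 𝓠 ≤ leftExtOrthogonal 𝓕) : HasCompleteResolution 𝓟 𝓠 𝓕 ≤ cosyzygyClass 𝓠 𝓕 := by
  rintro X ⟨E, hE, hE𝓕, hE𝓟, hE𝓠, ⟨e⟩⟩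
  have hEO (i : ℤ) : leftExtOrthogonal 𝓕 (E.X i) :=
    (lt_or_ge i 0).elim (fun hi => hP _ (hE𝓟 i hi)) fun hi => hQ _ (hE𝓠 i hi)
  have hcycles := (homExact_iff_forall_cycles hE hEO).1 hE𝓕
  obtain ⟨e'⟩ := nonempty_image_d_iso_cycles E (i := -1) (j := 0) (by simp) (hE 0)
  refine ⟨fun Y => ∃ i : ℤ, 0 ≤ i ∧ Nonempty (Y ≅ E.cycles i), ⟨?_, ?_⟩, 0, le_rfl, ⟨e ≪≫ e'⟩⟩
  · rintro Y ⟨i, -, ⟨e⟩⟩ H hH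
    exact (hcycles i H hH).of_iso_left e
  · rintro Y ⟨i, hi, ⟨e⟩⟩
    exact ⟨_, _, hE𝓠 i hi, ⟨i + 1, by lia, ⟨Iso.refl _⟩⟩,
      (isSES_cycles E (by simp) (hE _)).of_iso e.symm (Iso.refl _) (Iso.refl _)⟩

lemma hasCompleteResolution_eq_cosyzygyClass (hP : 𝓟 ≤ leftExtOrthogonal 𝓕)
    (hQ : 𝓠 ≤ leftExtOrthogonal 𝓕) (hPX : ∀ X, ∃ P K, 𝓟 P ∧ IsSES K P X) :
    HasCompleteResolution 𝓟 𝓠 𝓕 = cosyzygyClass 𝓠 𝓕 :=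
  le_antisymm (hasCompleteResolution_le_cosyzygyClass hP hQ)
    ((isCosyzygyClosed_cosyzygyClass 𝓠 𝓕).le_hasCompleteResolution hP hPX)

lemma le_cosyzygyClass [𝓠.ContainsZero] (hQ : 𝓠 ≤ leftExtOrthogonal 𝓕) : 𝓠 ≤ cosyzygyClass 𝓠 𝓕 :=
  IsCosyzygyClosed.le_cosyzygyClass ⟨hQ, fun Q hQ =>
    let ⟨Z, hZ, hZ𝓠⟩ := 𝓠.exists_prop_of_containsZero
    ⟨Q, Z, hQ, hZ𝓠, isSES_of_isZero_right hZ⟩⟩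

instance : (cosyzygyClass 𝓠 𝓕).IsClosedUnderIsomorphisms where
  of_iso {X Y} e hX := by
    have h := isCosyzygyClosed_cosyzygyClass 𝓠 𝓕
    refine IsCosyzygyClosed.le_cosyzygyClass (𝓧 := (cosyzygyClass 𝓠 𝓕).isoClosure) ⟨?_, ?_⟩ Y
      ⟨X, hX, ⟨e.symm⟩⟩
    · rintro Y ⟨X, hX, ⟨e⟩⟩ H hH
      exact (h.le X hX H hH).of_iso_left e
    · rintro Y ⟨X, hX, ⟨e⟩⟩
      obtain ⟨Q, Z, hQ, hZ, hS⟩ := h.exists_cosyzygy X hX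
      exact ⟨Q, Z, hQ, ⟨Z, hZ, ⟨Iso.refl Z⟩⟩, hS.of_iso e.symm (Iso.refl _) (Iso.refl _)⟩

lemma isClosedUnderExtensions_cosyzygyClass (h𝓠𝓕 : 𝓠 ≤ 𝓕)
    (h𝓠 : ∀ Q Q', 𝓠 Q → 𝓠 Q' → 𝓠 (Q ⊞ Q')) : (cosyzygyClass 𝓠 𝓕).IsClosedUnderExtensions where
  prop_X₂_of_shortExact {S} hS hS₁ hS₃ := by
    have h := isCosyzygyClosed_cosyzygyClass 𝓠 𝓕
    refine IsCosyzygyClosed.le_cosyzygyClass (𝓧 := fun Y => ∃ X Z, cosyzygyClass 𝓠 𝓕 X ∧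
      cosyzygyClass 𝓠 𝓕 Z ∧ IsSES X Y Z) ⟨?_, ?_⟩ _ ⟨_, _, hS₁, hS₃, .of_shortExact hS⟩
    · rintro Y ⟨X, Z, hX, hZ, hS⟩ H hH
      exact hS.extOrtho_left₂ (h.le X hX H hH) (h.le Z hZ H hH)
    · rintro Y ⟨X, Z, hX, hZ, hS⟩
      obtain ⟨I, X', hI, hX', hXI⟩ := h.exists_cosyzygy X hX
      obtain ⟨J, Z', hJ, hZ', hZJ⟩ := h.exists_cosyzygy Z hZ
      obtain ⟨Y', hY, hY'⟩ := hS.horseshoe hXI hZJ (h.le Z hZ I (h𝓠𝓕 I hI) 0)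
      exact ⟨_, Y', h𝓠 I J hI hJ, ⟨X', Z', hX', hZ', hY'⟩, hY⟩

lemma IsSES.cosyzygyClass_left [(cosyzygyClass 𝓠 𝓕).IsClosedUnderExtensions] {X Y Z : A}
    (hS : IsSES X Y Z) (hY : cosyzygyClass 𝓠 𝓕 Y) (hZ : cosyzygyClass 𝓠 𝓕 Z) :
    cosyzygyClass 𝓠 𝓕 X := by
  have h := isCosyzygyClosed_cosyzygyClass 𝓠 𝓕
  refine IsCosyzygyClosed.le_cosyzygyClass (𝓧 := fun W => W = X ∨ cosyzygyClass 𝓠 𝓕 W) ⟨?_, ?_⟩ X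
    (.inl rfl)
  · rintro W (rfl | hW) H hH
    exacts [hS.extOrtho_left₁ (h.le Y hY H hH) (h.le Z hZ H hH), h.le W hW H hH]
  · rintro W (rfl | hW)
    · obtain ⟨Q, Y', hQ, hY', hYQ⟩ := h.exists_cosyzygy Y hY
      obtain ⟨L, hWL, i, p, w, hL⟩ := hS.cokernel_comp hYQ
      exact ⟨Q, L, hQ, .inr (ObjectProperty.prop_X₂_of_shortExact _ hL hZ hY'), hWL⟩
    · obtain ⟨Q, W', hQ, hW', hWQ⟩ := h.exists_cosyzygy W hW
      exact ⟨Q, W', hQ, .inr hW', hWQ⟩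

end CompleteResolutions

section Approximations

variable {A : Type u} [Category.{v} A] [Abelian A] {𝓠 𝓓 : ObjectProperty A}

lemma exists_precover_of_hull [𝓓.IsClosedUnderExtensions] {X₁ G₀ X Y₁ G₁ : A}
    (hS : IsSES X₁ G₀ X) (hG₀ : 𝓓 G₀) (hS₁ : IsSES X₁ Y₁ G₁) (hG₁ : 𝓓 G₁) :
    ∃ G, IsSES Y₁ G X ∧ 𝓓 G := by
  obtain ⟨G, hG, i, p, w, hG₀G⟩ := hS.pushout hS₁
  exact ⟨G, hG, 𝓓.prop_X₂_of_shortExact hG₀G hG₀ hG₁⟩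

lemma isResolved_of_hull [𝓓.IsClosedUnderIsomorphisms] (h𝓠 : 𝓠 ≤ 𝓓)
    (hker : ∀ ⦃X Y Z⦄, IsSES X Y Z → 𝓓 Y → 𝓓 Z → 𝓓 X) {X Y G : A} {n : ℕ} (hS : IsSES X Y G)
    (hG : 𝓓 G) (hY : IsResolved 𝓠 n Y) : IsResolved 𝓓 n X := by
  cases n with
  | zero =>
    obtain ⟨Q, hQ, ⟨e⟩⟩ := hY
    exact 𝓓.le_isoClosure X (hker hS (𝓓.prop_of_iso e.symm (h𝓠 Q hQ)) hG)
  | succ n =>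
    obtain ⟨Q, K, hQ, hS', hK⟩ := hY
    obtain ⟨W, hKW, hWQ⟩ := hS'.kernel_comp hS
    exact ⟨W, K, hker hWQ (h𝓠 Q hQ) hG, hKW, hK.mono h𝓠⟩

variable [HasExt.{v} A]

lemma extOrtho_of_isResolved {X K : A} {n : ℕ} (hX : leftExtOrthogonal 𝓠 X)
    (hK : IsResolved 𝓠 n K) : ExtOrtho X K := by
  induction n generalizing K with
  | zero =>
    obtain ⟨Q, hQ, ⟨e⟩⟩ := hK
    exact (hX Q hQ).of_iso_right e.symm
  | succ n ih =>
    obtain ⟨Q, L, hQ, hS, hL⟩ := hK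
    exact hS.extOrtho_right₃ (ih hL) (hX Q hQ)

lemma isSpecialPrecover_id {X : A} (hX : 𝓓 X) : IsSpecialPrecover 𝓓 (0 : 0 ⟶ X) (𝟙 X) where
  zero := zero_comp
  shortExact := (ShortComplex.Splitting.ofIsZeroOfIsIso (.mk (0 : 0 ⟶ X) (𝟙 X) zero_comp)
    (isZero_zero A) (inferInstanceAs (IsIso (𝟙 X)))).shortExact
  mem := hX
  ext_one _ _ :=
    have : Injective (0 : A) := (isZero_zero A).injective
    Abelian.Ext.subsingleton_of_injective _ _ 0

namespace IsCosyzygyClosed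

variable (h𝓓 : IsCosyzygyClosed 𝓠 𝓠 𝓓)
include h𝓓

lemma exists_hull_of_precover {K G X : A} {n : ℕ} (hS : IsSES K G X) (hG : 𝓓 G)
    (hK : IsResolved 𝓠 n K) : ∃ Y G', IsSES X Y G' ∧ 𝓓 G' ∧ IsResolved 𝓠 (n + 1) Y := by
  obtain ⟨Q, G', hQ, hG', hGQ⟩ := h𝓓.exists_cosyzygy G hG
  obtain ⟨Y, hY, hXY⟩ := hS.cokernel_comp hGQ
  exact ⟨Y, G', hXY, hG', Q, K, hQ, hY, hK⟩

variable [𝓓.IsClosedUnderIsomorphisms] [𝓓.IsClosedUnderExtensions]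

lemma exists_hull {X : A} {n : ℕ} (hX : IsResolved 𝓓 n X) :
    ∃ Y G, IsSES X Y G ∧ 𝓓 G ∧ IsResolved 𝓠 n Y := by
  induction n generalizing X with
  | zero =>
    rw [IsResolved, 𝓓.isoClosure_eq_self] at hX
    obtain ⟨Q, G, hQ, hG, hS⟩ := h𝓓.exists_cosyzygy X hX
    exact ⟨Q, G, hS, hG, 𝓠.le_isoClosure Q hQ⟩
  | succ n ih =>
    obtain ⟨G₀, X₁, hG₀, hS, hX₁⟩ := hX
    obtain ⟨Y₁, G₁, hS₁, hG₁, hY₁⟩ := ih hX₁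
    obtain ⟨G, hGX, hG⟩ := exists_precover_of_hull hS hG₀ hS₁ hG₁
    exact h𝓓.exists_hull_of_precover hGX hG hY₁

lemma exists_precover {X : A} {n : ℕ} (hX : IsResolved 𝓓 (n + 1) X) :
    ∃ K G, IsSES K G X ∧ 𝓓 G ∧ IsResolved 𝓠 n K := by
  obtain ⟨G₀, X₁, hG₀, hS, hX₁⟩ := hX
  obtain ⟨Y₁, G₁, hS₁, hG₁, hY₁⟩ := h𝓓.exists_hull hX₁
  obtain ⟨G, hGX, hG⟩ := exists_precover_of_hull hS hG₀ hS₁ hG₁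
  exact ⟨Y₁, G, hGX, hG, hY₁⟩

variable (h𝓠 : 𝓠 ≤ 𝓓)
include h𝓠

theorem exists_hull_of_resolutionDim_eq
    (hker : ∀ ⦃X Y Z⦄, IsSES X Y Z → 𝓓 Y → 𝓓 Z → 𝓓 X) {X : A} {n : ℕ}
    (hX : resolutionDim 𝓓 X = n) : ∃ (Y G : A) (i : X ⟶ Y) (p : Y ⟶ G) (w : i ≫ p = 0),
      (ShortComplex.mk i p w).ShortExact ∧ 𝓓 G ∧ resolutionDim 𝓠 Y = n := by
  rw [resolutionDim_eq_iff] at hX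
  obtain ⟨Y, G, hS, hG, hY⟩ := h𝓓.exists_hull hX.1
  have hYn : resolutionDim 𝓠 Y = n :=
    resolutionDim_eq_iff.2 ⟨hY, fun m hm => hX.2 (isResolved_of_hull h𝓠 hker hS hG hm)⟩
  obtain ⟨i, p, w, hS⟩ := hS
  exact ⟨Y, G, i, p, w, hS, hG, hYn⟩

theorem exists_isSpecialPrecover_of_resolutionDim_eq {X : A} {n : ℕ}
    (hX : resolutionDim 𝓓 X = n) : ∃ (K G : A) (i : K ⟶ G) (p : G ⟶ X),
      IsSpecialPrecover 𝓓 i p ∧ (0 < n → resolutionDim 𝓠 K = ((n - 1 : ℕ) : ℕ∞)) ∧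
        (n = 0 → IsZero K) := by
  obtain ⟨hX, hmin⟩ := resolutionDim_eq_iff.1 hX
  cases n with
  | zero =>
    replace hX : 𝓓.isoClosure X := hX
    rw [𝓓.isoClosure_eq_self] at hX
    exact ⟨0, X, 0, 𝟙 X, isSpecialPrecover_id hX, fun hn => absurd hn (lt_irrefl 0),
      fun _ => isZero_zero A⟩
  | succ n =>
    obtain ⟨K, G, hS, hG, hK⟩ := h𝓓.exists_precover hX
    have hKn : resolutionDim 𝓠 K = n := resolutionDim_eq_iff.2 ⟨hK, fun m hm =>
      Nat.le_of_succ_le_succ (hmin ⟨G, K, hG, hS, hm.mono h𝓠⟩)⟩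
    obtain ⟨i, p, w, hS⟩ := hS
    exact ⟨K, G, i, p, ⟨w, hS, hG, fun F hF => extOrtho_of_isResolved (h𝓓.le F hF) hK 0⟩,
      fun _ => hKn, fun hn => absurd hn n.succ_ne_zero⟩

end IsCosyzygyClosed

end Approximations

section Modules

variable {R : Type u} [CommRing R]

lemma extOrtho_iff_of_projectiveResolution {A : Type u} [Category.{v} A] [Abelian A]
    [HasExt.{v} A] {X : A} (P : ProjectiveResolution X) (Y : A) :
    ExtOrtho X Y ↔ ∀ (n : ℕ) (f : P.complex.X (n + 1) ⟶ Y),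
      P.complex.d (n + 2) (n + 1) ≫ f = 0 → ∃ g, P.complex.d (n + 1) n ≫ g = f := by
  rw [extOrtho_iff]
  refine forall_congr' fun n => ⟨fun h f hf => ?_, fun h x => ?_⟩
  · exact (P.extMk_eq_zero_iff f (n + 2) rfl hf n rfl).1 (h _)
  · obtain ⟨f, hf, rfl⟩ := P.extMk_surjective x (n + 2) rfl
    exact (P.extMk_eq_zero_iff f (n + 2) rfl hf n rfl).2 (h f hf)

lemma rTensorHomEquivHomRTensor_lcomp {M M' N F : Type u} [AddCommGroup M] [Module R M]
    [AddCommGroup M'] [Module R M'] [AddCommGroup N] [Module R N] [AddCommGroup F] [Module R F]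
    [Module.Projective R M] [Module.Finite R M] [Module.Projective R M'] [Module.Finite R M']
    (d : M' →ₗ[R] M) (x : (M →ₗ[R] N) ⊗[R] F) :
    rTensorHomEquivHomRTensor R M' N F ((d.lcomp R N).rTensor F x) =
      rTensorHomEquivHomRTensor R M N F x ∘ₗ d := by
  induction x with
  | zero => simp
  | add x y hx hy => simp only [map_add, hx, hy, LinearMap.add_comp]
  | tmul f y => ext m; simp

/-- As the terms of `P` are finitely generated projective, `Hom(P, N ⊗ F) ≃ Hom(P, N) ⊗ F`, and
tensoring with `F` preserves the exactness of `Hom(P, N)` in positive degrees. -/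
lemma extOrtho_tensor_flat {M N : ModuleCat.{u} R} (P : ProjectiveResolution M)
    (hP : ∀ n, Module.Finite R (P.complex.X n)) (hMN : ExtOrtho M N) (F : Type u)
    [AddCommGroup F] [Module R F] [Module.Flat R F] :
    ExtOrtho M (ModuleCat.of R (N ⊗[R] F)) := by
  rw [extOrtho_iff_of_projectiveResolution P] at hMN ⊢
  intro n f hf
  have hproj (n) : Module.Projective R (P.complex.X n) :=
    (IsProjective.iff_projective _).2 (P.projective n)
  have hex : Function.Exact ((P.complex.d (n + 1) n).hom.lcomp R N)
      ((P.complex.d (n + 2) (n + 1)).hom.lcomp R N) := by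
    refine fun k => ⟨fun hk => ?_, ?_⟩
    · obtain ⟨g, hg⟩ := hMN n (ModuleCat.ofHom k) (ModuleCat.hom_ext hk)
      exact ⟨g.hom, congrArg ModuleCat.Hom.hom hg⟩
    · rintro ⟨g, rfl⟩
      exact congrArg ModuleCat.Hom.hom
        (P.complex.d_comp_d_assoc (n + 2) (n + 1) n (ModuleCat.ofHom g) |>.trans zero_comp)
  let e (n : ℕ) := rTensorHomEquivHomRTensor R (P.complex.X n) N F
  obtain ⟨y, hy⟩ := (Module.Flat.rTensor_exact F hex ((e (n + 1)).symm f.hom)).1 (by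
    apply (e (n + 2)).injective
    rw [map_zero, rTensorHomEquivHomRTensor_lcomp, LinearEquiv.apply_symm_apply]
    exact congrArg ModuleCat.Hom.hom hf)
  have hey : e n y ∘ₗ (P.complex.d (n + 1) n).hom = f.hom := by
    rw [← rTensorHomEquivHomRTensor_lcomp, hy, LinearEquiv.apply_symm_apply]
  exact ⟨ModuleCat.ofHom (e n y), ModuleCat.hom_ext hey⟩

lemma shortExact_rTensor {S : ShortComplex (ModuleCat.{u} R)} (hS : S.ShortExact) (P : Type u)
    [AddCommGroup P] [Module R P] [Module.Flat R P] :
    (ShortComplex.mk (ModuleCat.ofHom (S.f.hom.rTensor P)) (ModuleCat.ofHom (S.g.hom.rTensor P))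
      (by rw [← ModuleCat.ofHom_comp, ← LinearMap.rTensor_comp, ← ModuleCat.hom_comp, S.zero]
          simp)).ShortExact :=
  ModuleCat.shortComplex_shortExact _
    (Module.Flat.rTensor_exact P
      ((ShortComplex.ShortExact.moduleCat_exact_iff_function_exact S).1 hS.exact))
    (Module.Flat.rTensor_preserves_injective_linearMap _ hS.moduleCat_injective_f)
    (LinearMap.rTensor_surjective P hS.moduleCat_surjective_g)

lemma exists_extension_rTensor {M M' N P : Type u} [AddCommGroup M] [Module R M]
    [AddCommGroup M'] [Module R M'] [AddCommGroup N] [Module R N] [AddCommGroup P] [Module R P]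
    [Module.Projective R P] (f : M →ₗ[R] M') (hf : Function.Surjective (f.lcomp R N))
    (k : M ⊗[R] P →ₗ[R] N) : ∃ l : M' ⊗[R] P →ₗ[R] N, l ∘ₗ f.rTensor P = k := by
  obtain ⟨l, hl⟩ := Module.projective_lifting_property (f.lcomp R N)
    (TensorProduct.curry k).flip hf
  refine ⟨TensorProduct.lift l.flip, TensorProduct.ext' fun x y => ?_⟩
  simpa using LinearMap.congr_fun (LinearMap.congr_fun hl y) x

lemma extOrtho_tensor_projective {M N : ModuleCat.{u} R} (hMN : ExtOrtho M N) (P : Type u)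
    [AddCommGroup P] [Module R P] [Module.Projective R P] :
    ExtOrtho (ModuleCat.of R (M ⊗[R] P)) N := by
  refine extOrtho_of_exists_syzygy (𝓦 := fun W => ∃ M : ModuleCat.{u} R, ExtOrtho M N ∧
    W = ModuleCat.of R (M ⊗[R] P)) ?_ ⟨M, hMN, rfl⟩
  rintro _ ⟨M, hMN, rfl⟩
  obtain ⟨S, hS, hS₂, rfl⟩ := exists_shortExact_projective M
  have := (IsProjective.iff_projective _).2 hS₂
  have : Projective (ModuleCat.of R (S.X₂ ⊗[R] P)) :=
    (IsProjective.iff_projective _).1 inferInstance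
  refine ⟨_, shortExact_rTensor hS P, rfl,
    ⟨_, IsSES.extOrtho_left₁ (.of_shortExact hS) (extOrtho_of_projective S.X₂ N) hMN, rfl⟩,
    extOrtho_of_projective _ N, fun k => ?_⟩
  obtain ⟨l, hl⟩ := exists_extension_rTensor (N := N) _ (fun f => by
    obtain ⟨g, hg⟩ := exists_extension_of_subsingleton_ext_one hS (hMN 0) (ModuleCat.ofHom f)
    exact ⟨g.hom, congrArg ModuleCat.Hom.hom hg⟩) k.hom
  exact ⟨ModuleCat.ofHom l, ModuleCat.hom_ext hl⟩

lemma cProjMod_le_leftExtOrthogonal_cFlatMod {C : ModuleCat.{u} R} (P : ProjectiveResolution C)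
    (hP : ∀ n, Module.Finite R (P.complex.X n)) (hC : ExtOrtho C C) :
    cProjMod C ≤ leftExtOrthogonal (cFlatMod C) := by
  rintro M ⟨Q, hQ, ⟨e⟩⟩ N ⟨F, hF, ⟨e'⟩⟩
  have h := extOrtho_tensor_projective (extOrtho_tensor_flat P hP hC F) Q
  exact (h.of_iso_left e.toModuleIso).of_iso_right e'.symm.toModuleIso

lemma cProjMod_le_cFlatMod (C : ModuleCat.{u} R) : cProjMod C ≤ cFlatMod C :=
  fun _ ⟨P, _, e⟩ => ⟨P, inferInstance, e⟩

end Modules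

section Discs

variable {B : Type u} [Category.{v} B] [Abelian B]

/-- The direct sum over all `n` of the complexes `M n ⟶ M n` concentrated in degrees `n` and
`n - 1`; it is the complex freely generated by the graded object `M`. -/
noncomputable abbrev disc (M : ℤ → B) : ChainComplex B ℤ :=
  .of (fun n => M n ⊞ M (n + 1)) (fun _ => biprod.fst ≫ biprod.inr) (fun n => by simp)

/-- The morphism from `disc M` determined by its values on the generators `M n`. -/
noncomputable abbrev discDesc {M : ℤ → B} {Y : ChainComplex B ℤ} (φ : ∀ n, M n ⟶ Y.X n) :
    disc M ⟶ Y :=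
  ChainComplex.ofHom (fun n => biprod.desc (φ n) (φ (n + 1) ≫ Y.d (n + 1) n))
    fun n => by ext <;> simp

lemma disc_hom_ext {M : ℤ → B} {Y : ChainComplex B ℤ} {f g : disc M ⟶ Y}
    (h : ∀ n, (biprod.inl : M n ⟶ M n ⊞ M (n + 1)) ≫ f.f n = biprod.inl ≫ g.f n) : f = g := by
  ext n
  · exact h n
  · have hr : (biprod.inr : M (n + 1) ⟶ M n ⊞ M (n + 1)) =
      (biprod.inl : M (n + 1) ⟶ M (n + 1) ⊞ M (n + 1 + 1)) ≫ (disc M).d (n + 1) n := by simp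
    rw [hr, Category.assoc, Category.assoc, ← f.comm, ← g.comm, reassoc_of% (h (n + 1))]

/-- The functoriality of `disc`. -/
noncomputable abbrev discMap {M N : ℤ → B} (φ : ∀ n, M n ⟶ N n) : disc M ⟶ disc N :=
  ChainComplex.ofHom (fun n => biprod.map (φ n) (φ (n + 1))) fun n => by simp

lemma projective_disc (M : ℤ → B) [∀ n, Projective (M n)] : Projective (disc M) where
  factors f e he :=
    ⟨discDesc fun n => Projective.factorThru (biprod.inl ≫ f.f n) (e.f n),
      disc_hom_ext fun n => by simp⟩

lemma shortExact_disc {S : ℤ → ShortComplex B} (hS : ∀ n, (S n).ShortExact) :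
    (ShortComplex.mk (discMap fun n => (S n).f) (discMap fun n => (S n).g)
      (by ext <;> simp)).ShortExact :=
  HomologicalComplex.shortExact_of_degreewise_shortExact _ fun n =>
    shortExact_biprodMap (hS n) (hS (n + 1))

lemma extOrtho_disc [EnoughProjectives B] [HasExt.{v} B] [HasExt.{v} (ChainComplex B ℤ)]
    {M : ℤ → B} {Y : ChainComplex B ℤ} (h : ∀ n, ExtOrtho (M n) (Y.X n)) :
    ExtOrtho (disc M) Y := by
  refine extOrtho_of_exists_syzygy (𝓦 := fun W => ∃ M : ℤ → B,
    (∀ n, ExtOrtho (M n) (Y.X n)) ∧ W = disc M) ?_ ⟨M, h, rfl⟩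
  rintro _ ⟨M, h, rfl⟩
  choose S hS hS₂ hSM using fun n => exists_shortExact_projective (M n)
  obtain rfl : (fun n => (S n).X₃) = M := funext hSM
  have := projective_disc fun n => (S n).X₂
  have h₁ (n) : ExtOrtho (S n).X₁ (Y.X n) :=
    (IsSES.of_shortExact (hS n)).extOrtho_left₁ (extOrtho_of_projective _ _) (h n)
  refine ⟨_, shortExact_disc hS, rfl, ⟨_, h₁, rfl⟩, extOrtho_of_projective _ Y, fun k => ?_⟩
  choose l hl using fun n => exists_extension_of_subsingleton_ext_one (hS n) (h n 0)
    (biprod.inl ≫ k.f n)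
  exact ⟨discDesc l, disc_hom_ext fun n => by simp [hl]⟩

lemma acyclic_disc (M : ℤ → B) : (disc M).Acyclic := by
  intro n
  obtain ⟨n, rfl⟩ : ∃ m, n = m + 1 := ⟨n - 1, by lia⟩
  let σ : (ShortComplex.mk (biprod.inr : M (n + 1 + 1) ⟶ M (n + 1) ⊞ M (n + 1 + 1)) biprod.fst
      biprod.inr_fst).Splitting :=
    { r := biprod.snd, s := biprod.inl, id := by simp [add_comm, biprod.total] }
  exact exactAt_of_fac (disc M) (i := n + 1 + 1) (j := n + 1) (k := n) rfl rfl σ.shortExact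
    biprod.fst biprod.inr (by simp) (by simp)

lemma nonempty_cycles_disc_iso (M : ℤ → B) (n : ℤ) :
    Nonempty ((disc M).cycles n ≅ M (n + 1)) := by
  obtain ⟨e⟩ := nonempty_image_d_iso_cycles (disc M) (i := n + 1) (j := n) rfl (acyclic_disc M n)
  have := strongEpi_of_epi (biprod.fst : M (n + 1) ⊞ M (n + 1 + 1) ⟶ M (n + 1))
  exact ⟨e.symm ≪≫ (image.isoStrongEpiMono
    (biprod.fst : M (n + 1) ⊞ M (n + 1 + 1) ⟶ M (n + 1)) biprod.inr (by simp)).symm⟩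

lemma nonempty_retract_disc {X : ChainComplex B ℤ} (h : Homotopy (𝟙 X) 0) :
    Nonempty (Retract X (disc X.X)) := by
  have hh (n) : dNext n h.hom + h.hom n (n + 1) ≫ X.d (n + 1) n = 𝟙 (X.X n) := by
    simpa [prevD_eq h.hom (show (ComplexShape.down ℤ).Rel (n + 1) n from rfl)] using (h.comm n).symm
  let σ : X ⟶ disc X.X := ChainComplex.ofHom
    (fun n => biprod.lift (dNext n h.hom) (h.hom n (n + 1))) fun n => by
      ext
      · simp
      · simp [dNext_eq h.hom (show (ComplexShape.down ℤ).Rel (n + 1) n from rfl)]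
  exact ⟨σ, discDesc fun n => 𝟙 (X.X n), by ext n; simpa [σ] using hh n⟩

/-- The sequences `0 ⟶ Zₙ ⟶ Xₙ ⟶ Zₙ₋₁ ⟶ 0` of cycles split, and the contraction is the retraction
`Xₙ ⟶ Zₙ` followed by the section `Zₙ ⟶ Xₙ₊₁`. -/
lemma nonempty_homotopy_id_zero [HasExt.{v} B] {X : ChainComplex B ℤ} (hX : X.Acyclic)
    (hXX : ∀ i j, ExtOrtho (X.cycles i) (X.cycles j)) : Nonempty (Homotopy (𝟙 X) 0) := by
  have hr (n) : ∃ r : X.X n ⟶ X.cycles n, X.iCycles n ≫ r = 𝟙 _ :=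
    exists_extension_of_subsingleton_ext_one
      (shortExact_cycles X (i := n) (j := n - 1) (by simp) (hX _)) (hXX _ _ 0) _
  choose r hr using hr
  have hhom (i j) : ∃ h : X.X i ⟶ X.X j, (¬ (ComplexShape.down ℤ).Rel j i → h = 0) ∧
      ((ComplexShape.down ℤ).Rel j i → h ≫ X.d j i = r i ≫ X.iCycles i ∧
        X.d j i ≫ h = 𝟙 _ - r j ≫ X.iCycles j) := by
    by_cases hji : (ComplexShape.down ℤ).Rel j i
    · have hS := shortExact_cycles X hji (hX i)
      obtain ⟨s, hs, hrs⟩ : ∃ s, s ≫ X.toCycles j i = 𝟙 _ ∧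
          r j ≫ X.iCycles j + X.toCycles j i ≫ s = 𝟙 _ :=
        let σ := ShortComplex.Splitting.ofExactOfRetraction _ hS.exact (r j) (hr j) hS.epi_g
        ⟨σ.s, σ.s_g, σ.id⟩
      refine ⟨r i ≫ s, fun h => (h hji).elim, fun _ => ⟨?_, ?_⟩⟩
      · rw [← X.toCycles_i j i, Category.assoc, reassoc_of% hs]
      · rw [← X.toCycles_i j i, Category.assoc, reassoc_of% (hr i)]
        exact eq_sub_of_add_eq' hrs
    · exact ⟨0, fun _ => rfl, fun h => (hji h).elim⟩
  choose h h₀ hd using hhom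
  refine ⟨⟨h, fun i j => h₀ i j, fun n => ?_⟩⟩
  rw [dNext_eq h (show (ComplexShape.down ℤ).Rel n (n - 1) by simp),
    prevD_eq h (show (ComplexShape.down ℤ).Rel (n + 1) n from rfl), (hd _ _ (by simp)).2,
    (hd _ _ (by simp)).1]
  simp

lemma extOrtho_of_homotopy_id_zero [EnoughProjectives B] [HasExt.{v} B]
    [HasExt.{v} (ChainComplex B ℤ)] {X Y : ChainComplex B ℤ} (h : Homotopy (𝟙 X) 0)
    (hXY : ∀ n, ExtOrtho (X.X n) (Y.X n)) : ExtOrtho X Y :=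
  (extOrtho_disc hXY).of_retract_left (nonempty_retract_disc h).some

end Discs

section Tilde

variable {B : Type u} [Category.{v} B] [Abelian B]

lemma nonempty_cycles_biprod_iso (X Y : ChainComplex B ℤ) (n : ℤ) :
    Nonempty ((X ⊞ Y).cycles n ≅ X.cycles n ⊞ Y.cycles n) :=
  have : (HomologicalComplex.cyclesFunctor B (.down ℤ) n).Additive :=
    ⟨fun {X Y f g} => by
      change HomologicalComplex.cyclesMap (f + g) n =
        HomologicalComplex.cyclesMap f n + HomologicalComplex.cyclesMap g n
      simp [← cancel_mono (Y.iCycles n)]⟩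
  have := preservesBinaryBiproducts_of_preservesBiproducts
    (HomologicalComplex.cyclesFunctor B (.down ℤ) n)
  ⟨(HomologicalComplex.cyclesFunctor B (.down ℤ) n).mapBiprod X Y⟩

variable {R : Type u} [CommRing R] {𝓧 𝓨 : ObjectProperty (ModuleCat.{u} R)}

instance : (projMod : ObjectProperty (ModuleCat.{u} R)).IsClosedUnderIsomorphisms where
  of_iso e (_ : Module.Projective R _) := Module.Projective.of_equiv e.toLinearEquiv

instance (C : ModuleCat.{u} R) : (cProjMod C).IsClosedUnderIsomorphisms where
  of_iso := fun e ⟨P, hP, ⟨e'⟩⟩ => ⟨P, hP, ⟨e.symm.toLinearEquiv ≪≫ₗ e'⟩⟩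

instance (C : ModuleCat.{u} R) : (cProjMod C).ContainsZero where
  exists_zero := ⟨ModuleCat.of R PUnit, ModuleCat.isZero_of_subsingleton _,
    ModuleCat.of R PUnit, inferInstanceAs (Module.Projective R PUnit.{u + 1}), ⟨0⟩⟩

lemma cProjMod_biprod {C M N : ModuleCat.{u} R} (hM : cProjMod C M) (hN : cProjMod C N) :
    cProjMod C (M ⊞ N) := by
  obtain ⟨P, hP, ⟨e⟩⟩ := hM
  obtain ⟨Q, hQ, ⟨e'⟩⟩ := hN
  exact ⟨ModuleCat.of R (P × Q), inferInstanceAs (Module.Projective R (P × Q)),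
    ⟨(ModuleCat.biprodIsoProd M N).toLinearEquiv ≪≫ₗ e.prodCongr e' ≪≫ₗ
      (TensorProduct.prodRight R R C P Q).symm⟩⟩

instance [𝓧.IsClosedUnderIsomorphisms] : (tilde 𝓧).IsClosedUnderIsomorphisms where
  of_iso := fun e ⟨hX, hX'⟩ => ⟨fun i => (hX i).of_iso e,
    fun i => 𝓧.prop_of_iso ((HomologicalComplex.cyclesFunctor _ _ i).mapIso e) (hX' i)⟩

instance [𝓧.IsClosedUnderIsomorphisms] [𝓧.ContainsZero] : (tilde 𝓧).ContainsZero where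
  exists_zero := ⟨0, isZero_zero _,
    fun i => ShortComplex.exact_of_isZero_X₂ _
      (Functor.map_isZero (HomologicalComplex.eval _ _ i) (isZero_zero _)),
    fun i => 𝓧.prop_of_isZero
      (Functor.map_isZero (HomologicalComplex.cyclesFunctor _ _ i) (isZero_zero _))⟩

lemma tilde_biprod [𝓧.IsClosedUnderIsomorphisms] (h𝓧 : ∀ M N, 𝓧 M → 𝓧 N → 𝓧 (M ⊞ N))
    {X Y : Ch R} (hX : tilde 𝓧 X) (hY : tilde 𝓧 Y) : tilde 𝓧 (X ⊞ Y) :=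
  ⟨(ShortComplex.Splitting.ofHasBinaryBiproduct X Y).shortExact.acyclic_X₂ hX.1 hY.1, fun i =>
    𝓧.prop_of_iso (nonempty_cycles_biprod_iso X Y i).some.symm (h𝓧 _ _ (hX.2 i) (hY.2 i))⟩

lemma tilde_mono (h : 𝓧 ≤ 𝓨) : tilde 𝓧 ≤ tilde 𝓨 :=
  fun _ hX => ⟨hX.1, fun i => h _ (hX.2 i)⟩

lemma extOrtho_X_of_tilde (h : 𝓧 ≤ leftExtOrthogonal 𝓨) {X Y : Ch R} (hX : tilde 𝓧 X)
    (hY : tilde 𝓨 Y) (i j : ℤ) : ExtOrtho (X.X i) (Y.X j) := by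
  have isSES {Z : Ch R} (hZ : Z.Acyclic) (i : ℤ) : IsSES (Z.cycles i) (Z.X i) (Z.cycles (i - 1)) :=
    isSES_cycles Z (by simp) (hZ _)
  have key (M) (hM : 𝓧 M) : ExtOrtho M (Y.X j) :=
    (isSES hY.1 j).extOrtho_right₂ (h M hM _ (hY.2 _)) (h M hM _ (hY.2 _))
  exact (isSES hX.1 i).extOrtho_left₂ (key _ (hX.2 _)) (key _ (hX.2 _))

lemma tilde_le_leftExtOrthogonal_tilde (h𝓧 : 𝓧 ≤ leftExtOrthogonal 𝓧)
    (h : 𝓧 ≤ leftExtOrthogonal 𝓨) : tilde 𝓧 ≤ leftExtOrthogonal (tilde 𝓨) := by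
  intro X hX Y hY
  obtain ⟨H⟩ := nonempty_homotopy_id_zero hX.1 fun i j => h𝓧 _ (hX.2 i) _ (hX.2 j)
  exact extOrtho_of_homotopy_id_zero H fun n => extOrtho_X_of_tilde h hX hY n n

lemma projMod_le_leftExtOrthogonal (𝓨 : ObjectProperty (ModuleCat.{u} R)) :
    projMod ≤ leftExtOrthogonal 𝓨 := fun M hM N _ =>
  have := (IsProjective.iff_projective M).1 hM
  extOrtho_of_projective M N

lemma exists_tilde_projMod_presentation (X : Ch R) :
    ∃ P K : Ch R, tilde projMod P ∧ IsSES K P X := by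
  let p : disc (fun n => Projective.over (X.X n)) ⟶ X := discDesc fun n => Projective.π (X.X n)
  have : Epi p := HomologicalComplex.epi_of_epi_f p fun n =>
    have : Epi (biprod.inl ≫ p.f n) := by
      rw [show biprod.inl ≫ p.f n = Projective.π (X.X n) from biprod.inl_desc _ _]
      infer_instance
    epi_of_epi biprod.inl (p.f n)
  refine ⟨_, _, ⟨acyclic_disc _, fun i => ?_⟩, isSES_kernel_of_epi p⟩
  exact projMod.prop_of_iso (nonempty_cycles_disc_iso _ i).some.symm
    ((IsProjective.iff_projective _).2 (Projective.projective_over _))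

end Tilde

section DCProjective

variable {R : Type u} [CommRing R] {C : ModuleCat.{u} R} (P : ProjectiveResolution C)
  (hP : ∀ n, Module.Finite R (P.complex.X n)) (hC : ExtOrtho C C)
include P hP hC

lemma tilde_cProjMod_le_leftExtOrthogonal :
    tilde (cProjMod C) ≤ leftExtOrthogonal (tilde (cFlatMod C)) :=
  have h := cProjMod_le_leftExtOrthogonal_cFlatMod P hP hC
  tilde_le_leftExtOrthogonal_tilde (fun M hM N hN => h M hM N (cProjMod_le_cFlatMod C N hN)) h

lemma dcProjective_eq_cosyzygyClass :
    DCProjective C = cosyzygyClass (tilde (cProjMod C)) (tilde (cFlatMod C)) :=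
  hasCompleteResolution_eq_cosyzygyClass
    (tilde_le_leftExtOrthogonal_tilde (projMod_le_leftExtOrthogonal _)
      (projMod_le_leftExtOrthogonal _))
    (tilde_cProjMod_le_leftExtOrthogonal P hP hC) exists_tilde_projMod_presentation

end DCProjective

end RelDing

theorem corollary3p5_general {R : Type u} [CommRing R] (C : ModuleCat.{u} R)
    (P : ProjectiveResolution C) (hP : ∀ n, Module.Finite R (P.complex.X n))
    (hC : ∀ i : ℕ, 1 ≤ i → Subsingleton (Abelian.Ext C C i)) (X : RelDing.Ch R) (n : ℕ)
    (hX : RelDing.dcPd C X = (n : ℕ∞)) :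
    (∃ (Y G : RelDing.Ch R) (i : X ⟶ Y) (p : Y ⟶ G) (w : i ≫ p = 0),
      (ShortComplex.mk i p w).ShortExact ∧ RelDing.DCProjective C G ∧
        RelDing.pcPd C Y = (n : ℕ∞)) ∧
    (∃ (K G : RelDing.Ch R) (i : K ⟶ G) (p : G ⟶ X),
      RelDing.IsSpecialPrecover (RelDing.DCProjective C) i p ∧
        (0 < n → RelDing.pcPd C K = ((n - 1 : ℕ) : ℕ∞)) ∧
        (n = 0 → IsZero K)) := by
  have hCC : RelDing.ExtOrtho C C := fun i => hC (i + 1) (Nat.le_add_left 1 i)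
  have h𝓠 := RelDing.tilde_cProjMod_le_leftExtOrthogonal P hP hCC
  have h𝓠𝓕 := RelDing.tilde_mono (RelDing.cProjMod_le_cFlatMod C)
  have h𝓓 := (RelDing.isCosyzygyClosed_cosyzygyClass
    (RelDing.tilde (RelDing.cProjMod C)) _).anti h𝓠𝓕
  have := RelDing.isClosedUnderExtensions_cosyzygyClass h𝓠𝓕 fun _ _ =>
    RelDing.tilde_biprod fun _ _ => RelDing.cProjMod_biprod
  rw [RelDing.dcPd, RelDing.dcProjective_eq_cosyzygyClass P hP hCC] at hX
  rw [RelDing.dcProjective_eq_cosyzygyClass P hP hCC]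
  exact ⟨h𝓓.exists_hull_of_resolutionDim_eq (RelDing.le_cosyzygyClass h𝓠)
      (fun _ _ _ => RelDing.IsSES.cosyzygyClass_left) hX,
    h𝓓.exists_isSpecialPrecover_of_resolutionDim_eq (RelDing.le_cosyzygyClass h𝓠) hX⟩

theorem corollary3p5 {R : Type u} [CommRing R] (C : ModuleCat.{u} R)
    (hC : RelDing.IsSemidualizing C) (X : RelDing.Ch R) (n : ℕ)
    (hX : RelDing.dcPd C X = (n : ℕ∞)) :
    (∃ (Y G : RelDing.Ch R) (i : X ⟶ Y) (p : Y ⟶ G) (w : i ≫ p = 0),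
      (ShortComplex.mk i p w).ShortExact ∧ RelDing.DCProjective C G ∧
        RelDing.pcPd C Y = (n : ℕ∞)) ∧
    (∃ (K G : RelDing.Ch R) (i : K ⟶ G) (p : G ⟶ X),
      RelDing.IsSpecialPrecover (RelDing.DCProjective C) i p ∧
        (0 < n → RelDing.pcPd C K = ((n - 1 : ℕ) : ℕ∞)) ∧
        (n = 0 → IsZero K)) :=
  let ⟨P, hP⟩ := hC.exists_resolution
  corollary3p5_general C P hP hC.ext_self X n hX
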